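/- Let $N\ge 1$ and let $\beta=(\beta_1,\dots,\beta_N)\in\mathbb C^N$ satisfy $\sum_{i=1}^N\beta_i=N(N-1)/2$. Put $P_\beta(D)=\prod_{i=1}^N(D-\beta_i)$, $D_x=x\partial_x$, $D_z=z\partial_z$, and let $L_\beta=x^{-N}P_\beta(D_x)$ be the Bessel operator. Let $\Psi_\beta(z)=e^{z}\bigl(1+\sum_{k\ge1}a_k(\beta)z^{-k}\bigr)$ be the unique formal solution of this form of $P_\beta(D_z)\Psi=z^N\Psi$, let $\Psi_\beta(x,z)=\Psi_\beta(xz)$ be the Bessel wave function, and let $$V_\beta=\operatorname{span}\{\partial_x^k\Psi_\beta(x,z)|_{x=1} : k\ge0\}$$ be the Bessel plane. Differential operators have coefficients that are functions of $x$ near $x=1$ (formal power series in $x-1$). A wave function $\Psi_W$ is a Darboux transformation of a wave function $\Psi_V$ if there are monic polynomials $f,g$ and differential operators $P(x,\partial_x)$, $Q(x,\partial_x)$ with $\Psi_W=\frac1{g(z)}P\Psi_V$ and $\Psi_V=\frac1{f(z)}Q\Psi_W$. The parameter $\beta\in\mathbb C^N$ is generic if $\Psi_\beta$ is not a Darboux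 transformation of any Bessel wave function $\Psi_{\beta'}$ with $\beta'\in\mathbb C^{N'}$, $1\le N'<N$, $\sum_i\beta'_i=N'(N'-1)/2$. The spectral algebra of $V_\beta$ is $A_{V_\beta}=\{f\in\mathbb C[z] : fV_\beta\subset V_\beta\}$, and $\mathcal A_{V_\beta}$ is the algebra of the differential operators $L(x,\partial_x)$ for which there is $f\in A_{V_\beta}$ with $L\Psi_\beta(x,z)=f(z)\Psi_\beta(x,z)$. If $\beta$ is generic, then $$A_{V_\beta}=\mathbb C[z^N]\qquad\text{and}\qquad \mathcal A_{V_\beta}=\mathbb C[L_\beta].$$ -/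

import Mathlib

open Polynomial PowerSeries

noncomputable section

namespace BesselPlane

/-!
Conventions.  The spectral variable `z` enters through formal Laurent series in `z⁻¹`: an element
of `HahnSeries ℤ R` with coefficient `c n` at `n` stands for `∑ n, c n * z ^ (-n)`, so that only
finitely many positive powers of `z` occur.  The variable `x` is expanded at the base point `x = 1`:
a function of `x` is a formal power series in `X = x - 1`.
-/

/-- Functions of `x`, expanded at `x = 1`: formal power series in `X = x - 1`. -/
abbrev XFun : Type := PowerSeries ℂ

/-- The formal Laurent series in `z⁻¹` with complex coefficients. An element is used both for
itself and (after division by `e ^ z`) for an element of `e ^ z ℂ((z⁻¹))`. -/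
abbrev ZSeries : Type := HahnSeries ℤ ℂ

/-- The space of formal wave functions: the series `∑ c n (x) z ^ (-n)` with coefficients in
`XFun` stands for the formal expression `e ^ (x z) * ∑ c n (x) z ^ (-n)`. -/
abbrev WaveSpace : Type := HahnSeries ℤ XFun

/-! The coefficientwise structures of `ℂ`-algebra. They are Mathlib's; they are selected here
explicitly because Mathlib also offers a second, propositionally equal path to them. -/

instance (priority := 2000) zSeriesAlgebra : Algebra ℂ ZSeries := HahnSeries.instAlgebra

instance (priority := 2000) zSeriesModule : Module ℂ ZSeries := Algebra.toModule

instance (priority := 2000) zSeriesSMul : SMul ℂ ZSeries := Algebra.toSMul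

instance (priority := 2000) waveSpaceAlgebra : Algebra ℂ WaveSpace := HahnSeries.instAlgebra

instance (priority := 2000) waveSpaceModule : Module ℂ WaveSpace := Algebra.toModule

instance (priority := 2000) waveSpaceSMul : SMul ℂ WaveSpace := Algebra.toSMul

/-- The function `x = 1 + X`. -/
def xCoord : XFun := 1 + PowerSeries.X

/-- The variable `z` in `ℂ((z⁻¹))`. -/
def zVar : ZSeries := HahnSeries.single (-1) 1

/-- The variable `z` acting on wave functions by multiplication. -/
def zWave : WaveSpace := HahnSeries.single (-1) 1

/-! ### Differential operators in `x` -/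

/-- Multiplication of wave functions by a function of `x`. -/
def mulX (a : XFun) : Module.End ℂ WaveSpace :=
  LinearMap.mulLeft ℂ (HahnSeries.C a : WaveSpace)

/-- Coefficientwise derivative with respect to `x`. -/
def coeffDeriv : Module.End ℂ WaveSpace where
  toFun m := m.map (PowerSeries.derivative ℂ)
  map_add' m n := by ext; simp
  map_smul' r m := by ext; simp

/-- The derivation `∂ₓ` on wave functions:
`∂ₓ (e ^ (x z) m) = e ^ (x z) (z m + ∂m/∂x)`. -/
def dX : Module.End ℂ WaveSpace :=
  LinearMap.mulLeft ℂ zWave + coeffDeriv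

/-- The algebra of ordinary differential operators `∑ aⱼ(x) ∂ₓ ^ j`: the algebra of operators on
wave functions that is generated by `∂ₓ` and the multiplications by functions of `x`. (It acts
faithfully on wave functions.) -/
def DiffOp : Subalgebra ℂ (Module.End ℂ WaveSpace) :=
  Algebra.adjoin ℂ (insert dX (Set.range mulX))

/-- The Euler operator `Dₓ = x ∂ₓ`. -/
def eulerX : Module.End ℂ WaveSpace := mulX xCoord * dX

/-- The polynomial `P_β(D) = (D - β₁) ⋯ (D - β_N)`. -/
def besselPoly {N : ℕ} (β : Fin N → ℂ) : ℂ[X] :=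
  ∏ i, (Polynomial.X - Polynomial.C (β i))

/-- The Bessel operator `L_β = x ^ (-N) P_β(Dₓ)`. -/
def besselOp {N : ℕ} (β : Fin N → ℂ) : Module.End ℂ WaveSpace :=
  mulX (xCoord⁻¹ ^ N) * aeval eulerX (besselPoly β)

/-! ### The Bessel wave function -/

/-- The operator `z d/dz` on formal Laurent series in `z⁻¹`. -/
def thetaZ : Module.End ℂ ZSeries where
  toFun c :=
    { coeff := fun n => -(n : ℂ) * c.coeff n
      isPWO_support' := c.isPWO_support.mono fun n hn => by
        simp only [Function.mem_support] at hn
        exact right_ne_zero_of_mul hn }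
  map_add' c d := by ext; simp; ring
  map_smul' r c := by ext; simp; ring

/-- The Euler operator `D_z = z ∂_z` on `e ^ z ℂ((z⁻¹))`, after division by `e ^ z`:
`D_z (e ^ z c) = e ^ z (z c + z dc/dz)`. -/
def eulerZ : Module.End ℂ ZSeries := LinearMap.mulLeft ℂ zVar + thetaZ

/-- `e ^ z * ∑ aₖ z ^ (-k)`, with `a₀ = 1`, is a formal solution of the equation
`P_β(D_z) Φ = z ^ N Φ`. The power series `a` is in the variable `z⁻¹`. -/
def IsBesselSeries {N : ℕ} (β : Fin N → ℂ) (a : PowerSeries ℂ) : Prop :=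
  PowerSeries.constantCoeff a = 1 ∧
    aeval eulerZ (besselPoly β) (HahnSeries.ofPowerSeries ℤ ℂ a) =
      zVar ^ N * HahnSeries.ofPowerSeries ℤ ℂ a

theorem coeff_eulerZ (c : ZSeries) (n : ℤ) :
    (eulerZ c).coeff n = c.coeff (n + 1) - n * c.coeff n := by
  simp only [eulerZ, zVar, LinearMap.add_apply, LinearMap.mulLeft_apply, HahnSeries.coeff_add,
    HahnSeries.coeff_single_mul, thetaZ, LinearMap.coe_mk, AddHom.coe_mk]
  rw [sub_neg_eq_add]
  ring

theorem coeff_aeval_besselPoly {N : ℕ} (β : Fin N → ℂ) :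
    ∃ G : ℤ → (ℤ → ℂ) → ℂ, (∀ n, G n 0 = 0) ∧
      (∀ (n : ℤ) (f g : ℤ → ℂ), (∀ m : ℤ, m < n + N - 1 → f m = g m) → G n f = G n g) ∧
      ∀ (c : ZSeries) (n : ℤ), (aeval eulerZ (besselPoly β) c).coeff n =
        c.coeff (n + N) + (-(N * n : ℂ) - N * (N - 1) / 2 - ∑ i, β i) * c.coeff (n + N - 1) +
          G n c.coeff := by
  induction N with
  | zero => exact ⟨fun _ _ => 0, by simp, by simp, by simp [besselPoly]⟩
  | succ N ih =>
    obtain ⟨G, hG0, hG, h⟩ := ih (fun i => β i.succ)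
    refine ⟨fun n f => G (n + 1) f - (n + β 0) *
      ((-(N * n : ℂ) - N * (N - 1) / 2 - ∑ i : Fin N, β i.succ) * f (n + N - 1) + G n f),
      fun n => by simp [hG0], fun n f g hfg => ?_, fun c n => ?_⟩
    · simp only
      rw [hG (n + 1) f g fun m hm => hfg m (by push_cast; omega),
        hG n f g fun m hm => hfg m (by push_cast; omega), hfg _ (by push_cast; omega)]
    · have key : aeval eulerZ (besselPoly β) c =
          eulerZ (aeval eulerZ (besselPoly fun i => β i.succ) c) -
            β 0 • aeval eulerZ (besselPoly fun i => β i.succ) c := by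
        rw [besselPoly, Fin.prod_univ_succ, map_mul, Module.End.mul_apply]
        simp [besselPoly, Module.algebraMap_end_apply]
      rw [key, HahnSeries.coeff_sub, HahnSeries.coeff_smul, coeff_eulerZ, h, h,
        Fin.sum_univ_succ]
      have e1 : n + 1 + (N : ℤ) = n + ((N + 1 : ℕ) : ℤ) := by push_cast; ring
      have e2 : n + 1 + (N : ℤ) - 1 = n + N := by ring
      have e3 : n + ((N + 1 : ℕ) : ℤ) - 1 = n + N := by push_cast; ring
      rw [e2, e1, e3]
      push_cast
      simp only [smul_eq_mul]
      ring

/-- The coefficients of a formal solution are determined by a recursion. -/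
theorem isBesselSeries_iff {N : ℕ} (β : Fin N → ℂ) (hβ : ∑ i, β i = (N : ℂ) * ((N : ℂ) - 1) / 2) :
    ∃ H : ℤ → (ℤ → ℂ) → ℂ, (∀ n, H n 0 = 0) ∧
      (∀ (n : ℤ) (f g : ℤ → ℂ), (∀ m : ℤ, m < n → f m = g m) → H n f = H n g) ∧
      ∀ a : PowerSeries ℂ, IsBesselSeries β a ↔ PowerSeries.constantCoeff a = 1 ∧
        ∀ k : ℤ, (N * k : ℂ) * (HahnSeries.ofPowerSeries ℤ ℂ a).coeff k =
          H k (HahnSeries.ofPowerSeries ℤ ℂ a).coeff := by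
  obtain ⟨G, hG0, hG, h⟩ := coeff_aeval_besselPoly β
  refine ⟨fun k => G (k - N + 1), fun n => hG0 _, fun n f g hfg => hG _ _ _ fun m hm =>
    hfg m (by omega), fun a => and_congr_right fun _ => ?_⟩
  rw [HahnSeries.ext_iff, funext_iff]
  have hz : zVar ^ N = HahnSeries.single (-(N : ℤ)) (1 : ℂ) := by simp [zVar]
  rw [(Equiv.subRight ((N : ℤ) - 1)).surjective.forall]
  refine forall_congr' fun k => ?_
  rw [h, hz, HahnSeries.coeff_single_mul, hβ]
  simp only [Equiv.subRight_apply]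
  have e1 : k - ((N : ℤ) - 1) + N - 1 = k := by ring
  have e2 : k - ((N : ℤ) - 1) - -(N : ℤ) = k - ((N : ℤ) - 1) + N := by ring
  have e3 : k - ((N : ℤ) - 1) = k - N + 1 := by ring
  rw [e1, e2, e3]
  push_cast
  constructor
  · intro hh
    linear_combination -hh
  · intro hh
    linear_combination -hh

theorem coeff_ofPowerSeries_int (a : PowerSeries ℂ) (k : ℤ) :
    (HahnSeries.ofPowerSeries ℤ ℂ a).coeff k =
      if 0 ≤ k then PowerSeries.coeff k.toNat a else 0 := by
  split_ifs with hk
  · lift k to ℕ using hk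
    simp
  · rw [HahnSeries.ofPowerSeries_apply]
    refine HahnSeries.embDomain_of_notMem_range ?_
    rintro ⟨n, hn⟩
    apply hk
    rw [← hn]
    simp

/-- The formal solution `e ^ z * ∑ aₖ z ^ (-k)` of the Bessel equation exists and is unique. -/
theorem existsUnique_isBesselSeries {N : ℕ} (hN : 1 ≤ N) (β : Fin N → ℂ)
    (hβ : ∑ i, β i = (N : ℂ) * ((N : ℂ) - 1) / 2) : ∃! a, IsBesselSeries β a := by
  obtain ⟨H, hH0, hH, hiff⟩ := isBesselSeries_iff β hβ
  have hN0 : (N : ℂ) ≠ 0 := by exact_mod_cast (by omega : N ≠ 0)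
  let F : (k : ℕ) → ((m : ℕ) → m < k → ℂ) → ℂ := fun k r =>
    if k = 0 then 1 else
      H k (fun m => if h : 0 ≤ m ∧ m < k then r m.toNat (by omega) else 0) / (N * k)
  let a : ℕ → ℂ := fun k => Nat.strongRec F k
  have ha : ∀ k, a k = F k fun m _ => a m := fun k => by
    simp only [a]
    rw [Nat.strongRec_eq]
  refine ⟨PowerSeries.mk a, (hiff _).2 ⟨?_, fun k => ?_⟩, fun b hb => ?_⟩
  · rw [← PowerSeries.coeff_zero_eq_constantCoeff_apply, PowerSeries.coeff_mk, ha]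
    simp [F]
  · rcases lt_or_ge 0 k with hk | hk
    · lift k to ℕ using hk.le
      have hk0 : k ≠ 0 := by omega
      have hk1 : (k : ℂ) ≠ 0 := by exact_mod_cast hk0
      rw [coeff_ofPowerSeries_int, if_pos hk.le, PowerSeries.coeff_mk, Int.toNat_natCast, ha]
      simp only [F, if_neg hk0]
      rw [Int.cast_natCast, mul_div_cancel₀ _ (mul_ne_zero hN0 hk1)]
      refine hH _ _ _ fun m hm => ?_
      rw [coeff_ofPowerSeries_int, PowerSeries.coeff_mk]
      by_cases h0 : 0 ≤ m <;> simp [h0, hm]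
    · have : H k (HahnSeries.ofPowerSeries ℤ ℂ (PowerSeries.mk a)).coeff = 0 := by
        rw [← hH0 k]
        refine hH _ _ _ fun m hm => ?_
        rw [coeff_ofPowerSeries_int, if_neg (by omega)]
        rfl
      rw [this]
      rcases hk.lt_or_eq with h | h
      · rw [coeff_ofPowerSeries_int, if_neg (by omega), mul_zero]
      · simp [h]
  · obtain ⟨hb0, hb⟩ := (hiff b).1 hb
    ext k
    induction k using Nat.strong_induction_on with
    | _ k ih =>
      rw [PowerSeries.coeff_mk, ha]
      by_cases hk0 : k = 0
      · subst hk0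
        simpa [F] using hb0
      · have hk1 : (k : ℂ) ≠ 0 := by exact_mod_cast hk0
        simp only [F, if_neg hk0]
        rw [eq_div_iff (mul_ne_zero hN0 hk1), mul_comm]
        have := hb k
        rw [coeff_ofPowerSeries_int, if_pos (by omega), Int.toNat_natCast, Int.cast_natCast] at this
        rw [this]
        refine hH _ _ _ fun m hm => ?_
        rw [coeff_ofPowerSeries_int]
        by_cases h0 : 0 ≤ m
        · simp only [h0, hm, if_true, and_self, dif_pos]
          rw [ih _ (by omega), PowerSeries.coeff_mk]
        · simp [h0]

/-- The power series `∑ aₖ(β) z ^ (-k)` for which `e ^ z * ∑ aₖ(β) z ^ (-k)` is a formal solution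
of `P_β(D_z) Φ = z ^ N Φ`; see `existsUnique_isBesselSeries`. -/
def besselSeries {N : ℕ} (β : Fin N → ℂ) : PowerSeries ℂ :=
  Classical.epsilon (IsBesselSeries β)

theorem isBesselSeries_besselSeries {N : ℕ} (hN : 1 ≤ N) (β : Fin N → ℂ)
    (hβ : ∑ i, β i = (N : ℂ) * ((N : ℂ) - 1) / 2) : IsBesselSeries β (besselSeries β) :=
  Classical.epsilon_spec (existsUnique_isBesselSeries hN β hβ).exists

/-- The Bessel wave function `Ψ_β(x, z) = Ψ_β(x z) = e ^ (x z) * ∑ aₖ(β) x ^ (-k) z ^ (-k)`. -/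
def besselWave {N : ℕ} (β : Fin N → ℂ) : WaveSpace :=
  HahnSeries.ofPowerSeries ℤ XFun
    (PowerSeries.mk fun k => PowerSeries.C (PowerSeries.coeff k (besselSeries β)) * xCoord⁻¹ ^ k)

/-! ### Planes, spectral algebras, Darboux transformations -/

/-- Evaluation of a wave function at `x = 1`. (The common factor `e ^ z` is omitted.) -/
def evalOne (m : WaveSpace) : ZSeries := m.map (PowerSeries.constantCoeff (R := ℂ))

/-- The plane of a wave function `Ψ`: the span of the `∂ₓ ^ k Ψ` at `x = 1`.
(It is a plane in `e ^ z ℂ((z⁻¹))`; the common factor `e ^ z` is omitted.) -/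
def plane (Ψ : WaveSpace) : Submodule ℂ ZSeries :=
  Submodule.span ℂ (Set.range fun k : ℕ => evalOne ((dX ^ k) Ψ))

/-- The spectral algebra `A_W`: the polynomials `f(z)` that leave the plane `W` invariant. -/
def spectralAlgebra (W : Submodule ℂ ZSeries) : Subalgebra ℂ ℂ[X] where
  carrier := {f | ∀ w ∈ W, aeval zVar f * w ∈ W}
  mul_mem' {f g} hf hg w hw := by
    rw [map_mul, mul_assoc]
    exact hf _ (hg w hw)
  add_mem' {f g} hf hg w hw := by
    rw [map_add, add_mul]
    exact W.add_mem (hf w hw) (hg w hw)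
  algebraMap_mem' r w hw := by
    rw [AlgHom.commutes, ← Algebra.smul_def]
    exact W.smul_mem _ hw

theorem mul_zWave_comm {L : Module.End ℂ WaveSpace} (hL : L ∈ DiffOp) (m : WaveSpace) :
    L (zWave * m) = zWave * L m := by
  induction hL using Algebra.adjoin_induction generalizing m with
  | mem L hL =>
    rcases hL with rfl | ⟨a, rfl⟩
    · have h : coeffDeriv (zWave * m) = zWave * coeffDeriv m := by
        ext n
        simp [coeffDeriv, zWave, HahnSeries.coeff_single_mul]
      rw [dX, LinearMap.add_apply, LinearMap.add_apply, h, mul_add]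
      rfl
    · simp only [mulX, LinearMap.mulLeft_apply]
      ring
  | algebraMap r => simp [Module.algebraMap_end_apply]
  | add L M _ _ hL hM => simp only [LinearMap.add_apply, hL, hM, mul_add]
  | mul L M _ _ hL hM => simp only [Module.End.mul_apply, hL, hM]

theorem mul_aeval_zWave_comm {L : Module.End ℂ WaveSpace} (hL : L ∈ DiffOp) (f : ℂ[X])
    (m : WaveSpace) : L (aeval zWave f * m) = aeval zWave f * L m := by
  induction f using Polynomial.induction_on' generalizing m with
  | add p q hp hq => simp only [map_add, add_mul, hp, hq]
  | monomial n a =>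
    rw [aeval_monomial, ← Algebra.smul_def, smul_mul_assoc, map_smul, smul_mul_assoc]
    congr 1
    induction n generalizing m with
    | zero => simp
    | succ n ih => rw [pow_succ, mul_assoc, ih, mul_zWave_comm hL, mul_assoc]

/-- The algebra `𝒜_W` of the plane `W` of the wave function `Ψ`: the differential operators `L`
with `L Ψ = f(z) Ψ` for some `f` in the spectral algebra `A_W`. -/
def operatorAlgebra (Ψ : WaveSpace) : Subalgebra ℂ (Module.End ℂ WaveSpace) where
  carrier := {L | L ∈ DiffOp ∧ ∃ f ∈ spectralAlgebra (plane Ψ), L Ψ = aeval zWave f * Ψ}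
  mul_mem' := by
    rintro L M ⟨hL, f, hf, hLf⟩ ⟨hM, g, hg, hMg⟩
    refine ⟨mul_mem hL hM, f * g, mul_mem hf hg, ?_⟩
    rw [Module.End.mul_apply, hMg, mul_aeval_zWave_comm hL, hLf, map_mul]
    ring
  add_mem' := by
    rintro L M ⟨hL, f, hf, hLf⟩ ⟨hM, g, hg, hMg⟩
    refine ⟨add_mem hL hM, f + g, add_mem hf hg, ?_⟩
    rw [LinearMap.add_apply, hLf, hMg, map_add, add_mul]
  algebraMap_mem' r := by
    refine ⟨DiffOp.algebraMap_mem r, algebraMap ℂ ℂ[X] r, Subalgebra.algebraMap_mem _ r, ?_⟩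
    rw [AlgHom.commutes, ← Algebra.smul_def]
    simp [Module.algebraMap_end_apply]

/-- The wave function `Ψ'` is a Darboux transformation of the wave function `Ψ`:
`Ψ' = g(z)⁻¹ P(x, ∂ₓ) Ψ` and `Ψ = f(z)⁻¹ Q(x, ∂ₓ) Ψ'` for some monic polynomials `f`, `g` and
differential operators `P`, `Q`. -/
def IsDarbouxTransform (Ψ Ψ' : WaveSpace) : Prop :=
  ∃ f g : ℂ[X], f.Monic ∧ g.Monic ∧ ∃ P ∈ DiffOp, ∃ Q ∈ DiffOp,
    aeval zWave g * Ψ' = P Ψ ∧ aeval zWave f * Ψ = Q Ψ'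

/-- The parameters of the Bessel operators of order `N ≥ 1`:
`β₁ + ⋯ + β_N = N (N - 1) / 2`. -/
def IsBesselParam {N : ℕ} (β : Fin N → ℂ) : Prop :=
  1 ≤ N ∧ ∑ i, β i = (N : ℂ) * ((N : ℂ) - 1) / 2

/-- `β ∈ ℂ ^ N` is generic: the Bessel plane `V_β` is not a Darboux transformation of any
Bessel plane `V_β'` with `β' ∈ ℂ ^ N'`, `N' < N`. -/
def IsGeneric {N : ℕ} (β : Fin N → ℂ) : Prop :=
  ∀ N' : ℕ, N' < N → ∀ β' : Fin N' → ℂ, IsBesselParam β' →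
    ¬ IsDarbouxTransform (besselWave β') (besselWave β)

end BesselPlane

end

noncomputable section

namespace BesselPlane

/-! ### The Euler operator on formal Laurent series -/

/-! The plane of `Ψ_β` is the set of all `U(D_z) Ψ_β` with `U` a polynomial (`mem_plane_dilate`),
and `U` is determined by its value because `Ψ_β` has leading coefficient 1
(`aeval_eulerZ_injective`). Questions about the plane thus become questions about polynomials, under
the rule `U(D_z - k) z^k = z^k U(D_z)`.

The plane is stable under `D_z`, so its spectral algebra is stable under the derivation `z d/dz` and
is spanned by monomials. If `z^m` belongs to it, then `z^m Ψ_β = R(D_z) Ψ_β` for some `R`, and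
injectivity forces `P_β(X - m) R = R(X - N) P_β`. Comparing roots modulo `N ℤ`, the roots of `R`
cancel: the multiset of the classes of the `β_i` is invariant under translation by `m`
(`IsBesselParam.mem_translationStabilizer`), hence by `d = gcd(m, N)`.

Suppose `N ∤ m`, so that `d < N`, and let `r = N / d`. The invariant multiset splits into
progressions of step `d` and length `r`. Representatives can be chosen so that the first terms form
a Bessel parameter `β'` of length `d` (`exists_rel_bind_translates`). The full progressions form a
parameter `β''` whose Bessel equation is that of the `r`-th power of `L_β'`, so `Ψ_β'' = Ψ_β'`.
Since `β` and `β''` agree modulo `N ℤ`, explicit products of linear factors in `D` intertwine their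
equations (`exists_intertwiner`) and give a Darboux transformation, contradicting genericity.

The statement on operators follows because a differential operator is determined by its action on
one wave function (`eq_zero_of_apply_eq_zero`). -/

theorem zVar_pow (k : ℕ) : zVar ^ k = HahnSeries.single (-(k : ℤ)) (1 : ℂ) := by
  simp [zVar]

theorem coeff_zVar_pow_mul (k : ℕ) (c : ZSeries) (n : ℤ) :
    (zVar ^ k * c).coeff n = c.coeff (n + k) := by
  rw [zVar_pow, HahnSeries.coeff_single_mul, one_mul, sub_neg_eq_add]

theorem zVar_pow_ne_zero (k : ℕ) : zVar ^ k ≠ 0 := by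
  rw [zVar_pow]
  exact HahnSeries.single_ne_zero one_ne_zero

theorem eulerZ_zVar_pow_mul (k : ℕ) (c : ZSeries) :
    eulerZ (zVar ^ k * c) = zVar ^ k * (eulerZ c + (k : ℂ) • c) := by
  ext n
  rw [coeff_eulerZ, coeff_zVar_pow_mul, coeff_zVar_pow_mul, coeff_zVar_pow_mul,
    HahnSeries.coeff_add, HahnSeries.coeff_smul, coeff_eulerZ, smul_eq_mul,
    show n + 1 + (k : ℤ) = n + k + 1 by ring]
  push_cast
  ring

/-- Commutation of a polynomial in `D_z` with a power of `z`. -/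
theorem aeval_eulerZ_comp_zVar_pow_mul (k : ℕ) (U : ℂ[X]) (c : ZSeries) :
    aeval eulerZ (U.comp (Polynomial.X - Polynomial.C (k : ℂ))) (zVar ^ k * c) =
      zVar ^ k * aeval eulerZ U c := by
  have h1 : ∀ c, aeval eulerZ (Polynomial.X - Polynomial.C (k : ℂ)) (zVar ^ k * c) =
      zVar ^ k * eulerZ c := fun c => by
    rw [map_sub, aeval_X, aeval_C, LinearMap.sub_apply, eulerZ_zVar_pow_mul,
      Module.algebraMap_end_apply, mul_add, mul_smul_comm, add_sub_cancel_right]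
  rw [aeval_comp]
  generalize aeval eulerZ (Polynomial.X - Polynomial.C (k : ℂ)) = E at h1
  induction U using Polynomial.induction_on' generalizing c with
  | add p q hp hq => simp only [map_add, LinearMap.add_apply, hp, hq, mul_add]
  | monomial n r =>
    rw [aeval_monomial, aeval_monomial, Module.End.mul_apply, Module.End.mul_apply,
      Module.algebraMap_end_apply, Module.algebraMap_end_apply, mul_smul_comm]
    congr 1
    induction n generalizing c with
    | zero => simp
    | succ n ih => rw [pow_succ, pow_succ, Module.End.mul_apply, Module.End.mul_apply, h1, ih]

theorem coeff_eulerZ_pow (c : ZSeries) (hc : ∀ n < 0, c.coeff n = 0) (k : ℕ) :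
    (∀ n : ℤ, n < -k → ((eulerZ ^ k) c).coeff n = 0) ∧
      ((eulerZ ^ k) c).coeff (-k) = c.coeff 0 := by
  induction k with
  | zero => exact ⟨fun n hn => hc n (by simpa using hn), by simp⟩
  | succ k ih =>
    rw [pow_succ', Module.End.mul_apply]
    refine ⟨fun n hn => ?_, ?_⟩
    · push_cast at hn
      rw [coeff_eulerZ, ih.1 _ (by omega), ih.1 _ (by omega), mul_zero, sub_zero]
    · rw [coeff_eulerZ, ih.1 (-((k + 1 : ℕ) : ℤ)) (by push_cast; omega), mul_zero, sub_zero,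
        show -((k + 1 : ℕ) : ℤ) + 1 = -(k : ℤ) by push_cast; ring, ih.2]

/-- The leading term of `U(D_z) c`. -/
theorem coeff_aeval_eulerZ (c : ZSeries) (hc : ∀ n < 0, c.coeff n = 0) {U : ℂ[X]} {k : ℕ}
    (hU : U.natDegree ≤ k) :
    (∀ n : ℤ, n < -k → (aeval eulerZ U c).coeff n = 0) ∧
      (aeval eulerZ U c).coeff (-k) = U.coeff k * c.coeff 0 := by
  have h : ∀ n, (aeval eulerZ U c).coeff n =
      ∑ i ∈ Finset.range (k + 1), U.coeff i * ((eulerZ ^ i) c).coeff n := fun n => by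
    rw [aeval_eq_sum_range' (Nat.lt_succ_of_le hU), LinearMap.sum_apply, HahnSeries.coeff_sum]
    simp
  refine ⟨fun n hn => ?_, ?_⟩
  · rw [h]
    refine Finset.sum_eq_zero fun i hi => ?_
    rw [Finset.mem_range] at hi
    rw [(coeff_eulerZ_pow c hc i).1 n (by omega), mul_zero]
  · rw [h, Finset.sum_range_succ, (coeff_eulerZ_pow c hc k).2, Finset.sum_eq_zero, zero_add]
    intro i hi
    rw [Finset.mem_range] at hi
    rw [(coeff_eulerZ_pow c hc i).1 _ (by omega), mul_zero]

/-- As `c` begins with 1, the leading coefficient of `U` survives as the coefficient of `z^(deg U)`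
in `U(D_z) c`. -/
theorem aeval_eulerZ_injective (c : ZSeries) (hc : ∀ n < 0, c.coeff n = 0) (hc0 : c.coeff 0 = 1) :
    Function.Injective fun U : ℂ[X] => aeval eulerZ U c := by
  intro U V h
  by_contra hne
  have h0 : aeval eulerZ (U - V) c = 0 := by
    rw [map_sub, LinearMap.sub_apply, sub_eq_zero]
    exact h
  have h1 := (coeff_aeval_eulerZ c hc (le_refl (U - V).natDegree)).2
  rw [h0, hc0, mul_one] at h1
  exact sub_ne_zero.2 hne (leadingCoeff_eq_zero.1 h1.symm)

/-- The Bessel function `Ψ_β(z)`, divided by `e ^ z`. -/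
def besselFun {N : ℕ} (β : Fin N → ℂ) : ZSeries := HahnSeries.ofPowerSeries ℤ ℂ (besselSeries β)

/-! ### Characterization of the Bessel function by its equation -/

section

variable {N : ℕ} {β : Fin N → ℂ}

theorem coeff_besselFun_neg (β : Fin N → ℂ) (n : ℤ) (hn : n < 0) : (besselFun β).coeff n = 0 := by
  rw [besselFun, coeff_ofPowerSeries_int, if_neg (by omega)]

theorem IsBesselParam.coeff_besselFun_zero (hβ : IsBesselParam β) :
    (besselFun β).coeff 0 = 1 := by
  rw [besselFun, coeff_ofPowerSeries_int, if_pos le_rfl]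
  simpa using (isBesselSeries_besselSeries hβ.1 β hβ.2).1

theorem IsBesselParam.aeval_besselFun (hβ : IsBesselParam β) :
    aeval eulerZ (besselPoly β) (besselFun β) = zVar ^ N * besselFun β :=
  (isBesselSeries_besselSeries hβ.1 β hβ.2).2

theorem IsBesselParam.aeval_eulerZ_injective (hβ : IsBesselParam β) :
    Function.Injective fun U : ℂ[X] => aeval eulerZ U (besselFun β) :=
  BesselPlane.aeval_eulerZ_injective _ (coeff_besselFun_neg β) hβ.coeff_besselFun_zero

theorem IsBesselParam.eq_besselFun (hβ : IsBesselParam β) {c : ZSeries}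
    (hc : ∀ n < 0, c.coeff n = 0) (hc0 : c.coeff 0 = 1)
    (h : aeval eulerZ (besselPoly β) c = zVar ^ N * c) : c = besselFun β := by
  have hc1 : c = HahnSeries.ofPowerSeries ℤ ℂ (PowerSeries.mk fun n => c.coeff n) := by
    ext n
    rw [coeff_ofPowerSeries_int]
    split_ifs with hn
    · rw [PowerSeries.coeff_mk, Int.toNat_of_nonneg hn]
    · exact hc n (by omega)
  have h2 : (PowerSeries.mk fun n : ℕ => c.coeff n) = besselSeries β := by
    refine (existsUnique_isBesselSeries hβ.1 β hβ.2).unique ⟨?_, ?_⟩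
      (isBesselSeries_besselSeries hβ.1 β hβ.2)
    · rw [← PowerSeries.coeff_zero_eq_constantCoeff_apply, PowerSeries.coeff_mk]
      exact_mod_cast hc0
    · rw [← hc1, h]
  rw [hc1, h2, besselFun]

/-- An operator `U(D_z)` that intertwines two Bessel equations maps one Bessel function to the
other, up to a power of `z`. -/
theorem IsBesselParam.aeval_eq_zVar_pow_mul (hβ : IsBesselParam β) {β' : Fin N → ℂ}
    (hβ' : IsBesselParam β') {U : ℂ[X]} (hU : U.Monic)
    (h : (besselPoly β').comp (Polynomial.X - Polynomial.C (U.natDegree : ℂ)) * U =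
      U.comp (Polynomial.X - Polynomial.C (N : ℂ)) * besselPoly β) :
    aeval eulerZ U (besselFun β) = zVar ^ U.natDegree * besselFun β' := by
  obtain ⟨h1, h2⟩ := coeff_aeval_eulerZ (besselFun β) (coeff_besselFun_neg β) (le_refl U.natDegree)
  rw [hβ.coeff_besselFun_zero, mul_one, coeff_natDegree, hU] at h2
  generalize hk : U.natDegree = k at *
  obtain ⟨c, hc⟩ : ∃ c, aeval eulerZ U (besselFun β) = zVar ^ k * c :=
    ⟨(zVar ^ k)⁻¹ * aeval eulerZ U (besselFun β), by
      rw [← mul_assoc, mul_inv_cancel₀ (zVar_pow_ne_zero k), one_mul]⟩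
  rw [hc, ← hβ'.eq_besselFun (c := c)]
  · intro n hn
    have := h1 (n - k) (by omega)
    rwa [hc, coeff_zVar_pow_mul, sub_add_cancel] at this
  · rwa [hc, coeff_zVar_pow_mul, neg_add_cancel] at h2
  -- After multiplication by `z^k`, the equation for `c` is the intertwining relation `h` applied to
  -- `besselFun β`.
  · refine mul_left_cancel₀ (zVar_pow_ne_zero k) ?_
    rw [← aeval_eulerZ_comp_zVar_pow_mul, ← hc, ← Module.End.mul_apply, ← map_mul, h, map_mul,
      Module.End.mul_apply, hβ.aeval_besselFun, aeval_eulerZ_comp_zVar_pow_mul, hc]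
    ring

end

/-! ### Functions of `x z` -/

/-- The function `x` as a unit. -/
def xUnit : XFunˣ :=
  Units.mkOfMulEqOne xCoord xCoord⁻¹ (PowerSeries.mul_inv_cancel _ (by simp [xCoord]))

theorem xUnit_val : (xUnit : XFun) = xCoord := rfl

theorem xUnit_inv_val : ((xUnit⁻¹ : XFunˣ) : XFun) = xCoord⁻¹ := rfl

theorem xCoord_mul_inv : xCoord * xCoord⁻¹ = 1 := xUnit.mul_inv

theorem xUnit_zpow_add (m n : ℤ) :
    ((xUnit ^ (m + n) : XFunˣ) : XFun) = (xUnit ^ m : XFunˣ) * (xUnit ^ n : XFunˣ) := by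
  rw [zpow_add, Units.val_mul]

theorem constantCoeff_xUnit_zpow (n : ℤ) :
    PowerSeries.constantCoeff ((xUnit ^ n : XFunˣ) : XFun) = 1 := by
  let φ : XFunˣ →* ℂˣ := Units.map (PowerSeries.constantCoeff (R := ℂ)).toMonoidHom
  have h : φ xUnit = 1 := by
    ext
    change PowerSeries.constantCoeff xCoord = 1
    simp [xCoord]
  have h2 : φ (xUnit ^ n) = 1 := by rw [map_zpow, h, one_zpow]
  exact congrArg Units.val h2

/-- `x d/dx (x ^ n) = n x ^ n`. -/
theorem xCoord_mul_derivative_zpow (n : ℤ) :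
    xCoord * PowerSeries.derivative ℂ ((xUnit ^ n : XFunˣ) : XFun) =
      (n : ℂ) • ((xUnit ^ n : XFunˣ) : XFun) := by
  have hX : PowerSeries.derivative ℂ xCoord = 1 := by
    simp [xCoord]
  -- Leibniz for `x^n · x`. Since `x` is a unit, this can also be read from `n + 1` back to `n`, so
  -- the induction runs in both directions.
  have step : ∀ n : ℤ, xCoord * PowerSeries.derivative ℂ ((xUnit ^ (n + 1) : XFunˣ) : XFun) =
      xCoord * (xCoord * PowerSeries.derivative ℂ ((xUnit ^ n : XFunˣ) : XFun) +
        ((xUnit ^ n : XFunˣ) : XFun)) := fun n => by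
    rw [xUnit_zpow_add, zpow_one, xUnit_val, Derivation.leibniz, hX, smul_eq_mul, smul_eq_mul]
    ring
  have hcancel : ∀ {a b : XFun}, xCoord * a = xCoord * b → a = b := fun {a b} h =>
    xUnit.isUnit.mul_left_cancel h
  have rhs : ∀ n : ℤ, ((n + 1 : ℤ) : ℂ) • ((xUnit ^ (n + 1) : XFunˣ) : XFun) =
      xCoord * ((n : ℂ) • ((xUnit ^ n : XFunˣ) : XFun) + ((xUnit ^ n : XFunˣ) : XFun)) :=
    fun n => by
    rw [xUnit_zpow_add, zpow_one, xUnit_val, mul_add, mul_smul_comm, mul_comm xCoord]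
    push_cast
    rw [add_smul, one_smul]
  induction n using Int.induction_on with
  | zero => simp
  | succ n ih => rw [step, ih, rhs]
  | pred n ih =>
    rw [← sub_add_cancel (-(n : ℤ)) 1, step, rhs] at ih
    exact add_right_cancel (hcancel ih)

/-- The substitution `c(z) ↦ c(x z)`. -/
def dilate : ZSeries →ₗ[ℂ] WaveSpace where
  toFun c :=
    { coeff := fun n => c.coeff n • ((xUnit ^ (-n) : XFunˣ) : XFun)
      isPWO_support' := c.isPWO_support.mono fun n hn => by
        simp only [Function.mem_support] at hn
        exact left_ne_zero_of_smul hn }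
  map_add' c d := by ext1; funext n; simp [add_smul]
  map_smul' r c := by ext1; funext n; simp [mul_smul]

theorem coeff_dilate (c : ZSeries) (n : ℤ) :
    (dilate c).coeff n = c.coeff n • ((xUnit ^ (-n) : XFunˣ) : XFun) := rfl

theorem coeff_mulX (a : XFun) (m : WaveSpace) (n : ℤ) :
    (mulX a m).coeff n = a * m.coeff n := by
  rw [mulX, LinearMap.mulLeft_apply, HahnSeries.C_mul_eq_smul, HahnSeries.coeff_smul, smul_eq_mul]

theorem coeff_dX (m : WaveSpace) (n : ℤ) :
    (dX m).coeff n = m.coeff (n + 1) + PowerSeries.derivative ℂ (m.coeff n) := by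
  simp [dX, zWave, HahnSeries.coeff_single_mul, coeffDeriv]

theorem mulX_mul (a b : XFun) : mulX (a * b) = mulX a * mulX b := by
  refine LinearMap.ext fun m => HahnSeries.ext (funext fun n => ?_)
  rw [Module.End.mul_apply, coeff_mulX, coeff_mulX, coeff_mulX, mul_assoc]

theorem mulX_one : mulX 1 = 1 := by
  refine LinearMap.ext fun m => HahnSeries.ext (funext fun n => ?_)
  rw [coeff_mulX, one_mul, Module.End.one_apply]

theorem coeff_zWave_pow_mul (k : ℕ) (c : WaveSpace) (n : ℤ) :
    (zWave ^ k * c).coeff n = c.coeff (n + k) := by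
  rw [show zWave ^ k = HahnSeries.single (-(k : ℤ)) (1 : XFun) by simp [zWave],
    HahnSeries.coeff_single_mul, one_mul, sub_neg_eq_add]

theorem mulX_inv_pow_mulX_pow (k : ℕ) (m : WaveSpace) :
    mulX (xCoord⁻¹ ^ k) (mulX (xCoord ^ k) m) = m := by
  rw [← Module.End.mul_apply, ← mulX_mul, ← mul_pow, mul_comm, xCoord_mul_inv, one_pow, mulX_one, Module.End.one_apply]

/-- On functions of the product `x z` the two Euler operators coincide. This transfers every
computation in `x` to one in `z` alone. -/
theorem eulerX_dilate (c : ZSeries) : eulerX (dilate c) = dilate (eulerZ c) := by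
  ext1; funext n
  rw [eulerX, Module.End.mul_apply, coeff_mulX, coeff_dX, coeff_dilate, coeff_dilate, coeff_dilate,
    coeff_eulerZ, Derivation.map_smul, mul_add, mul_smul_comm, mul_smul_comm,
    xCoord_mul_derivative_zpow, ← xUnit_val]
  nth_rw 1 [← zpow_one xUnit]
  rw [← xUnit_zpow_add, sub_smul, smul_smul, show 1 + -(n + 1) = -n by ring, sub_eq_add_neg,
    ← neg_smul]
  congr 2
  push_cast
  ring

theorem aeval_eulerX_dilate (U : ℂ[X]) (c : ZSeries) :
    aeval eulerX U (dilate c) = dilate (aeval eulerZ U c) := by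
  induction U using Polynomial.induction_on' with
  | add p q hp hq => simp only [map_add, LinearMap.add_apply, hp, hq]
  | monomial n r =>
    rw [aeval_monomial, aeval_monomial, Module.End.mul_apply, Module.End.mul_apply,
      Module.algebraMap_end_apply, Module.algebraMap_end_apply, map_smul]
    congr 1
    induction n with
    | zero => simp
    | succ n ih => rw [pow_succ', pow_succ', Module.End.mul_apply, Module.End.mul_apply, ih,
        eulerX_dilate]

theorem dilate_zVar_pow_mul (k : ℕ) (c : ZSeries) :
    dilate (zVar ^ k * c) = mulX (xCoord ^ k) (zWave ^ k * dilate c) := by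
  ext1; funext n
  rw [coeff_dilate, coeff_zVar_pow_mul, coeff_mulX, coeff_zWave_pow_mul, coeff_dilate,
    mul_smul_comm, ← xUnit_val, ← Units.val_pow_eq_pow_val, ← zpow_natCast, ← xUnit_zpow_add]
  congr 3
  ring_nf

theorem evalOne_dilate (c : ZSeries) : evalOne (dilate c) = c := by
  ext n
  simp [evalOne, coeff_dilate, constantCoeff_xUnit_zpow]

theorem evalOne_mulX_inv_pow (k : ℕ) (m : WaveSpace) :
    evalOne (mulX (xCoord⁻¹ ^ k) m) = evalOne m := by
  ext n
  simp [evalOne, coeff_mulX, xCoord]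

theorem besselWave_eq_dilate {N : ℕ} (β : Fin N → ℂ) : besselWave β = dilate (besselFun β) := by
  ext1; funext n
  rw [coeff_dilate, besselFun, coeff_ofPowerSeries_int]
  split_ifs with hn
  · lift n to ℕ using hn
    rw [besselWave, HahnSeries.ofPowerSeries_apply_coeff, PowerSeries.coeff_mk, Int.toNat_natCast,
      zpow_neg, zpow_natCast, ← inv_pow, Units.val_pow_eq_pow_val, xUnit_inv_val,
      PowerSeries.smul_eq_C_mul]
  · rw [zero_smul, besselWave, HahnSeries.ofPowerSeries_apply]
    refine HahnSeries.embDomain_of_notMem_range ?_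
    rintro ⟨k, rfl⟩
    exact hn (Int.natCast_nonneg k)

/-! ### Differential operators -/

theorem mulX_mem_diffOp (a : XFun) : mulX a ∈ DiffOp :=
  Algebra.subset_adjoin (Set.mem_insert_of_mem _ ⟨a, rfl⟩)

theorem dX_mem_diffOp : dX ∈ DiffOp := Algebra.subset_adjoin (Set.mem_insert _ _)

theorem aeval_eulerX_mem_diffOp (U : ℂ[X]) : aeval eulerX U ∈ DiffOp := by
  have h : eulerX ∈ DiffOp := mul_mem (mulX_mem_diffOp _) dX_mem_diffOp
  rw [aeval_eq_sum_range]
  exact sum_mem fun i _ => DiffOp.smul_mem (pow_mem h i) _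

theorem dX_mul_mulX (a : XFun) :
    dX * mulX a = mulX a * dX + mulX (PowerSeries.derivative ℂ a) := by
  refine LinearMap.ext fun m => HahnSeries.ext (funext fun n => ?_)
  rw [LinearMap.add_apply, HahnSeries.coeff_add, Module.End.mul_apply, Module.End.mul_apply,
    coeff_mulX, coeff_dX, coeff_dX, coeff_mulX, coeff_mulX, coeff_mulX, Derivation.leibniz,
    smul_eq_mul, smul_eq_mul]
  ring

/-- The normal form `∑ aⱼ(x) ∂ₓ ^ j` of a differential operator. -/
theorem exists_eq_sum_of_mem_diffOp {L : Module.End ℂ WaveSpace} (hL : L ∈ DiffOp) :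
    ∃ a : ℕ →₀ XFun, L = a.sum fun j f => mulX f * dX ^ j := by
  let S : Submodule ℂ (Module.End ℂ WaveSpace) :=
    Submodule.span ℂ (Set.range fun p : ℕ × XFun => mulX p.2 * dX ^ p.1)
  have hS : ∀ (a : XFun) (j : ℕ), mulX a * dX ^ j ∈ S := fun a j =>
    Submodule.subset_span ⟨(j, a), rfl⟩
  have hmul : ∀ E : Module.End ℂ WaveSpace, (∀ (a : XFun) (j : ℕ), E * (mulX a * dX ^ j) ∈ S) →
      ∀ F ∈ S, E * F ∈ S := fun E hE F hF => by
    have : S ≤ S.comap (LinearMap.mulLeft ℂ E) := by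
      refine Submodule.span_le.2 ?_
      rintro _ ⟨⟨j, a⟩, rfl⟩
      exact hE a j
    exact this hF
  -- The span of the normal forms is stable under left multiplication by the generators: `∂ₓ` is
  -- moved past a function by the Leibniz rule.
  have hgen : ∀ E ∈ DiffOp, ∀ F ∈ S, E * F ∈ S := fun E hE => by
    induction hE using Algebra.adjoin_induction with
    | mem E hE =>
      refine hmul E fun a j => ?_
      rcases hE with rfl | ⟨b, rfl⟩
      · rw [← mul_assoc, dX_mul_mulX, add_mul, mul_assoc, ← pow_succ']
        exact S.add_mem (hS _ _) (hS _ _)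
      · rw [← mul_assoc, ← mulX_mul]
        exact hS _ _
    | algebraMap r =>
      intro F hF
      rw [← Algebra.smul_def]
      exact S.smul_mem r hF
    | add E E' _ _ h h' =>
      intro F hF
      rw [add_mul]
      exact S.add_mem (h F hF) (h' F hF)
    | mul E E' _ _ h h' =>
      intro F hF
      rw [mul_assoc]
      exact h _ (h' F hF)
  have hLS : L ∈ S := by
    have h1 := hgen L hL (mulX 1 * dX ^ 0) (hS 1 0)
    rwa [mulX_one, pow_zero, mul_one, mul_one] at h1
  have hadd : ∀ f g : XFun, mulX (f + g) = mulX f + mulX g := fun f g => by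
    rw [mulX, map_add]
    exact LinearMap.ext fun m => add_mul _ _ _
  have hzero : mulX 0 = 0 := by
    exact LinearMap.ext fun m => by rw [mulX, map_zero]; exact zero_mul m
  clear hL
  induction hLS using Submodule.span_induction with
  | mem E hE =>
    obtain ⟨⟨j, a⟩, rfl⟩ := hE
    exact ⟨Finsupp.single j a, by rw [Finsupp.sum_single_index (by simp [hzero])]⟩
  | zero => exact ⟨0, by simp⟩
  | add E F _ _ h h' =>
    obtain ⟨a, rfl⟩ := h
    obtain ⟨b, rfl⟩ := h'
    exact ⟨a + b, by
      rw [Finsupp.sum_add_index' (by simp [hzero]) (by simp [hadd, add_mul])]⟩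
  | smul r E _ h =>
    obtain ⟨a, rfl⟩ := h
    refine ⟨r • a, ?_⟩
    rw [Finsupp.sum_smul_index' (by simp [hzero]), Finsupp.smul_sum]
    refine Finsupp.sum_congr fun j _ => ?_
    rw [← smul_mul_assoc]
    congr 1
    refine LinearMap.ext fun m => HahnSeries.ext (funext fun n => ?_)
    simp [coeff_mulX]

theorem coeff_dX_pow (m : WaveSpace) (hm : ∀ n < 0, m.coeff n = 0) (k : ℕ) :
    (∀ n : ℤ, n < -k → ((dX ^ k) m).coeff n = 0) ∧ ((dX ^ k) m).coeff (-k) = m.coeff 0 := by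
  induction k with
  | zero => exact ⟨fun n hn => hm n (by simpa using hn), by simp⟩
  | succ k ih =>
    rw [pow_succ', Module.End.mul_apply]
    refine ⟨fun n hn => ?_, ?_⟩
    · push_cast at hn
      rw [coeff_dX, ih.1 _ (by omega), ih.1 _ (by omega), map_zero, add_zero]
    · rw [coeff_dX, ih.1 (-((k + 1 : ℕ) : ℤ)) (by push_cast; omega), map_zero, add_zero,
        show -((k + 1 : ℕ) : ℤ) + 1 = -(k : ℤ) by push_cast; ring, ih.2]

/-- A differential operator that annihilates a wave function is zero. -/
theorem eq_zero_of_apply_eq_zero {L : Module.End ℂ WaveSpace} (hL : L ∈ DiffOp) {m : WaveSpace}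
    (hm : ∀ n < 0, m.coeff n = 0) (hm0 : m.coeff 0 = 1) (h : L m = 0) : L = 0 := by
  obtain ⟨a, rfl⟩ := exists_eq_sum_of_mem_diffOp hL
  by_cases ha : a = 0
  · simp [ha]
  exfalso
  -- Since `m` begins with 1, `∂ₓ^j m` has no power of `z` above `z^j`. With `k` the order of the
  -- operator, the coefficient of `z^k` in the image is therefore the leading coefficient `a k`,
  -- which is nonzero.
  have hs : a.support.Nonempty := Finsupp.support_nonempty_iff.2 ha
  set k := a.support.max' hs with hk
  have hmem : k ∈ a.support := Finset.max'_mem _ hs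
  have h1 := congrArg (fun w : WaveSpace => w.coeff (-(k : ℤ))) h
  simp only [Finsupp.sum, LinearMap.sum_apply, HahnSeries.coeff_sum, Module.End.mul_apply,
    coeff_mulX, HahnSeries.coeff_zero] at h1
  rw [Finset.sum_eq_single_of_mem k hmem, (coeff_dX_pow m hm k).2, hm0, mul_one] at h1
  · exact Finsupp.mem_support_iff.1 hmem h1
  · intro j hj hjk
    have : j ≤ k := Finset.le_max' _ _ hj
    rw [(coeff_dX_pow m hm j).1 _ (by omega), mul_zero]

/-! ### The Bessel plane -/

theorem aeval_eulerZ_descPochhammer_succ (k : ℕ) (c : ZSeries) :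
    aeval eulerZ (descPochhammer ℂ (k + 1)) c = eulerZ (aeval eulerZ (descPochhammer ℂ k) c) -
      (k : ℂ) • aeval eulerZ (descPochhammer ℂ k) c := by
  rw [descPochhammer_succ_right, mul_comm, map_mul, Module.End.mul_apply, map_sub, aeval_X,
    ← Polynomial.C_eq_natCast, aeval_C, LinearMap.sub_apply, Module.algebraMap_end_apply]

/-- This is the classical `∂ₓ^k = x^(-k) D (D - 1) ⋯ (D - k + 1)`, read on functions of `x z`. -/
theorem dX_pow_dilate (c : ZSeries) (k : ℕ) : (dX ^ k) (dilate c) =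
    mulX (xCoord⁻¹ ^ k) (dilate (aeval eulerZ (descPochhammer ℂ k) c)) := by
  induction k with
  | zero => simp [mulX_one]
  | succ k ih =>
    have hx : PowerSeries.derivative ℂ (xCoord⁻¹ ^ k) = -(k : ℂ) • xCoord⁻¹ ^ (k + 1) := by
      have := xCoord_mul_derivative_zpow (-k)
      rw [zpow_neg, zpow_natCast, ← inv_pow, Units.val_pow_eq_pow_val, xUnit_inv_val] at this
      refine xUnit.isUnit.mul_left_cancel ?_
      rw [xUnit_val, this, mul_smul_comm, pow_succ', ← mul_assoc, xCoord_mul_inv, one_mul]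
      push_cast
      rfl
    have hd : ∀ m : WaveSpace, mulX (xCoord⁻¹ ^ k) (dX m) =
        mulX (xCoord⁻¹ ^ (k + 1)) (eulerX m) := fun m => by
      rw [eulerX, ← Module.End.mul_apply, ← Module.End.mul_apply, ← mul_assoc, ← mulX_mul,
        pow_succ, mul_assoc, mul_comm xCoord⁻¹, xCoord_mul_inv, mul_one]
    have hs : ∀ (r : ℂ) (f : XFun) (m : WaveSpace), mulX (r • f) m = mulX f (r • m) :=
      fun r f m => by
      ext1; funext n
      simp [coeff_mulX]
    have hneg : ∀ w : ZSeries, -(k : ℂ) • w = -((k : ℂ) • w) := fun w => neg_smul _ w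
    rw [pow_succ', Module.End.mul_apply, ih, ← Module.End.mul_apply, dX_mul_mulX,
      LinearMap.add_apply, Module.End.mul_apply, hd, hx, hs, ← map_add, eulerX_dilate, ← map_smul,
      ← map_add, aeval_eulerZ_descPochhammer_succ, sub_eq_add_neg, hneg]

/-- At `x = 1` the derivatives become falling factorials in `D_z`, and these span the same space as
the powers of `D_z`. -/
theorem mem_plane_dilate (c w : ZSeries) :
    w ∈ plane (dilate c) ↔ ∃ U : ℂ[X], aeval eulerZ U c = w := by
  have hgen : ∀ k : ℕ, evalOne ((dX ^ k) (dilate c)) = aeval eulerZ (descPochhammer ℂ k) c :=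
    fun k => by rw [dX_pow_dilate, evalOne_mulX_inv_pow, evalOne_dilate]
  have hplane : plane (dilate c) =
      Submodule.span ℂ (Set.range fun k : ℕ => aeval eulerZ (descPochhammer ℂ k) c) := by
    rw [plane]
    simp only [hgen]
  rw [hplane]
  constructor
  · intro hw
    induction hw using Submodule.span_induction with
    | mem w hw =>
      obtain ⟨k, rfl⟩ := hw
      exact ⟨_, rfl⟩
    | zero => exact ⟨0, by simp⟩
    | add v w _ _ hv hw =>
      obtain ⟨U, rfl⟩ := hv
      obtain ⟨U', rfl⟩ := hw
      exact ⟨U + U', by simp⟩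
    | smul r w _ hw =>
      obtain ⟨U, rfl⟩ := hw
      exact ⟨r • U, by simp⟩
  · rintro ⟨U, rfl⟩
    set S := Submodule.span ℂ (Set.range fun k : ℕ => aeval eulerZ (descPochhammer ℂ k) c) with hS
    have hmem : ∀ k : ℕ, aeval eulerZ (descPochhammer ℂ k) c ∈ S := fun k =>
      Submodule.subset_span ⟨k, rfl⟩
    have hstep : ∀ w ∈ S, eulerZ w ∈ S := fun w hw => by
      have : S ≤ S.comap eulerZ := by
        refine Submodule.span_le.2 ?_
        rintro _ ⟨k, rfl⟩
        have h1 : eulerZ (aeval eulerZ (descPochhammer ℂ k) c) =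
            aeval eulerZ (descPochhammer ℂ (k + 1)) c +
              (k : ℂ) • aeval eulerZ (descPochhammer ℂ k) c := by
          rw [aeval_eulerZ_descPochhammer_succ, sub_add_cancel]
        change eulerZ _ ∈ S
        rw [h1]
        exact S.add_mem (hmem _) (S.smul_mem _ (hmem _))
      exact this hw
    have hpow : ∀ n : ℕ, (eulerZ ^ n) c ∈ S := fun n => by
      induction n with
      | zero => simpa using hmem 0
      | succ n ih =>
        rw [pow_succ', Module.End.mul_apply]
        exact hstep _ ih
    rw [aeval_eq_sum_range, LinearMap.sum_apply]
    exact S.sum_mem fun i _ => S.smul_mem _ (hpow i)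

/-! ### Multisets invariant under a translation -/

section Translates

variable {A B : Type*} [AddCommGroup A] [AddCommGroup B]

/-- The arithmetic progression `a, a + δ, …, a + (r - 1) δ`. -/
def translates (δ : A) (r : ℕ) (a : A) : Multiset A :=
  (Multiset.range r).map fun j => a + j • δ

theorem map_translates (f : A →+ B) (δ : A) (r : ℕ) (a : A) :
    (translates δ r a).map f = translates (f δ) r (f a) := by
  simp [translates, Multiset.map_map]

theorem map_add_translates (δ : A) (r : ℕ) (a t : A) :
    (translates δ r a).map (· + t) = translates δ r (a + t) := by
  simp [translates, Multiset.map_map, add_right_comm]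

theorem translates_add {δ : A} {r : ℕ} (h : r • δ = 0) (a : A) :
    translates δ r (a + δ) = translates δ r a := by
  -- Both sides are the progression of length `r + 1` from `a`, split off at its first and at its
  -- last term.
  have key : ∀ r : ℕ, a ::ₘ translates δ r (a + δ) = (a + r • δ) ::ₘ translates δ r a := fun r => by
    induction r with
    | zero => simp [translates]
    | succ r ih =>
      have h1 : ∀ b : A, translates δ (r + 1) b = (b + r • δ) ::ₘ translates δ r b := fun b => by
        simp [translates, Multiset.range_succ]
      rw [h1, h1, Multiset.cons_swap, ih, add_assoc, ← succ_nsmul' δ r]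
  have := key r
  rwa [h, add_zero, Multiset.cons_inj_right] at this

theorem translates_add_zsmul {δ : A} {r : ℕ} (h : r • δ = 0) (a : A) (n : ℤ) :
    translates δ r (a + n • δ) = translates δ r a := by
  induction n using Int.induction_on with
  | zero => simp
  | succ n ih => rw [add_zsmul, one_zsmul, ← add_assoc, translates_add h, ih]
  | pred n ih =>
    rw [← ih, ← translates_add h, add_assoc, ← add_one_zsmul, sub_add_cancel]

/-- An element of `M` brings its whole orbit under `δ`, whose points are distinct. Removing that
orbit once leaves a smaller invariant multiset; finite order makes the orbit a finite progression.
-/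
theorem exists_eq_bind_translates {δ : A} (hδ : addOrderOf δ ≠ 0) (M : Multiset A)
    (hM : M.map (· + δ) = M) : ∃ K : Multiset A, M = K.bind (translates δ (addOrderOf δ)) := by
  induction M using Multiset.strongInductionOn with
  | _ M ih =>
    rcases M.empty_or_exists_mem with rfl | ⟨a, ha⟩
    · exact ⟨0, by simp⟩
    have hmem : ∀ j : ℕ, a + j • δ ∈ M := fun j => by
      induction j with
      | zero => simpa using ha
      | succ j ihj =>
        rw [succ_nsmul, ← add_assoc]
        nth_rw 1 [← hM]
        exact Multiset.mem_map_of_mem _ ihj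
    have hle : translates δ (addOrderOf δ) a ≤ M := by
      refine (Multiset.le_iff_subset ?_).2 fun b hb => ?_
      · refine (Multiset.nodup_map_iff_inj_on (Multiset.nodup_range _)).2 fun i hi j hj hij => ?_
        exact nsmul_injOn_Iio_addOrderOf (Multiset.mem_range.1 hi) (Multiset.mem_range.1 hj)
          (add_left_cancel hij)
      · obtain ⟨j, _, rfl⟩ := Multiset.mem_map.1 hb
        exact hmem j
    obtain ⟨M', rfl⟩ := Multiset.le_iff_exists_add.1 hle
    rw [Multiset.map_add, map_add_translates, translates_add (addOrderOf_nsmul_eq_zero δ)] at hM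
    obtain ⟨K, hK⟩ := ih M' (by
      refine lt_add_of_pos_left _ (pos_iff_ne_zero.2 fun h0 => hδ ?_)
      simpa [translates] using congrArg Multiset.card h0) (add_left_cancel hM)
    exact ⟨a ::ₘ K, by rw [Multiset.cons_bind, ← hK]⟩

/-- The group of the translations that preserve a multiset. -/
def translationStabilizer (M : Multiset A) : AddSubgroup A where
  carrier := {t | M.map (· + t) = M}
  zero_mem' := by simp
  add_mem' {s t} (hs : M.map (· + s) = M) (ht : M.map (· + t) = M) := by
    have h : (M.map (· + s)).map (· + t) = M := by rw [hs, ht]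
    simpa [Multiset.map_map, Function.comp_def, add_assoc] using h
  neg_mem' {t} (ht : M.map (· + t) = M) := by
    have h : (M.map (· + t)).map (· + -t) = M.map (· + -t) := by rw [ht]
    simpa [Multiset.map_map, Function.comp_def] using h.symm

end Translates

/-! ### Progressions of complex numbers and congruence modulo `N ℤ` -/

theorem sum_translates (δ : ℂ) (r : ℕ) (a : ℂ) :
    (translates δ r a).sum = r * a + δ * (r * (r - 1) / 2) := by
  induction r with
  | zero => simp [translates]
  | succ r ih =>
    have h1 : translates δ (r + 1) a = (a + r • δ) ::ₘ translates δ r a := by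
      simp [translates, Multiset.range_succ]
    rw [h1, Multiset.sum_cons, ih, nsmul_eq_mul]
    push_cast
    ring

theorem sum_bind_translates (δ : ℂ) (r : ℕ) (K : Multiset ℂ) :
    (K.bind (translates δ r)).sum = r * K.sum + K.card * (δ * (r * (r - 1) / 2)) := by
  induction K using Multiset.induction_on with
  | empty => simp
  | cons a K ih =>
    rw [Multiset.cons_bind, Multiset.sum_add, ih, sum_translates, Multiset.sum_cons,
      Multiset.card_cons]
    push_cast
    ring

theorem card_bind_translates {A : Type*} [AddCommGroup A] (δ : A) (r : ℕ) (K : Multiset A) :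
    (K.bind (translates δ r)).card = K.card * r := by
  simp [Multiset.card_bind, translates, Function.comp_def]

theorem exists_map_univ_eq {A : Type*} {N : ℕ} {s : Multiset A} (hs : s.card = N) :
    ∃ β : Fin N → A, Finset.univ.val.map β = s := by
  subst hs
  refine ⟨fun i => s.toList.get (i.cast s.length_toList.symm), ?_⟩
  rw [Fin.univ_val_map, ← List.ofFn_congr s.length_toList s.toList.get, List.ofFn_get,
    Multiset.coe_toList]

/-- The congruence of complex numbers modulo `N ℤ`. -/
def IntCongr (N : ℕ) (a b : ℂ) : Prop := ∃ n : ℤ, b = a + N * n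

theorem mk_eq_mk_iff_intCongr {N : ℕ} {a b : ℂ} :
    (a : ℂ ⧸ AddSubgroup.zmultiples (N : ℂ)) = b ↔ IntCongr N a b := by
  rw [QuotientAddGroup.eq, AddSubgroup.mem_zmultiples_iff]
  refine exists_congr fun n => ?_
  rw [zsmul_eq_mul, eq_neg_add_iff_add_eq, mul_comm, eq_comm]

theorem rel_intCongr_iff {N : ℕ} {s t : Multiset ℂ} : Multiset.Rel (IntCongr N) s t ↔
    s.map (QuotientAddGroup.mk' (AddSubgroup.zmultiples (N : ℂ))) =
      t.map (QuotientAddGroup.mk' (AddSubgroup.zmultiples (N : ℂ))) := by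
  rw [← Multiset.rel_eq, Multiset.rel_map]
  simp only [QuotientAddGroup.mk'_apply, mk_eq_mk_iff_intCongr]

theorem addOrderOf_mk {d r : ℕ} (hd : d ≠ 0) :
    addOrderOf (QuotientAddGroup.mk' (AddSubgroup.zmultiples ((d * r : ℕ) : ℂ)) (d : ℂ)) = r := by
  have h : ∀ j : ℕ, j • (QuotientAddGroup.mk' (AddSubgroup.zmultiples ((d * r : ℕ) : ℂ)) (d : ℂ)) = 0
      ↔ r ∣ j := fun j => by
    have hd' : (d : ℂ) ≠ 0 := Nat.cast_ne_zero.2 hd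
    rw [← map_nsmul, QuotientAddGroup.mk'_apply, QuotientAddGroup.eq_zero_iff,
      AddSubgroup.mem_zmultiples_iff, ← Int.natCast_dvd_natCast]
    constructor
    · rintro ⟨n, hn⟩
      refine ⟨n, ?_⟩
      have : (d : ℂ) * j = d * (r * n) := by
        simp only [zsmul_eq_mul, nsmul_eq_mul] at hn
        push_cast at hn
        linear_combination -hn
      exact_mod_cast mul_left_cancel₀ hd' this
    · rintro ⟨n, hn⟩
      refine ⟨n, ?_⟩
      have hn' : (j : ℂ) = r * n := by exact_mod_cast hn
      simp only [zsmul_eq_mul, nsmul_eq_mul]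
      push_cast
      rw [hn']
      ring
  refine Nat.dvd_antisymm (addOrderOf_dvd_of_nsmul_eq_zero ((h r).2 dvd_rfl)) ((h _).1 ?_)
  exact addOrderOf_nsmul_eq_zero _

/-- A Bessel parameter that is invariant under the translation by `d` modulo `d r ℤ` comes from a
Bessel parameter of length `d`. -/
theorem exists_rel_bind_translates {d r : ℕ} (hd : d ≠ 0) (hr : r ≠ 0) {M : Multiset ℂ}
    (hcard : M.card = d * r) (hsum : M.sum = ((d * r : ℕ) : ℂ) * (((d * r : ℕ) : ℂ) - 1) / 2)
    (hM : QuotientAddGroup.mk' (AddSubgroup.zmultiples ((d * r : ℕ) : ℂ)) (d : ℂ) ∈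
      translationStabilizer
        (M.map (QuotientAddGroup.mk' (AddSubgroup.zmultiples ((d * r : ℕ) : ℂ))))) :
    ∃ K : Multiset ℂ, K.card = d ∧ K.sum = (d : ℂ) * ((d : ℂ) - 1) / 2 ∧
      (K.bind (translates (d : ℂ) r)).sum = M.sum ∧
      Multiset.Rel (IntCongr (d * r)) M (K.bind (translates (d : ℂ) r)) := by
  set π := QuotientAddGroup.mk' (AddSubgroup.zmultiples ((d * r : ℕ) : ℂ)) with hπ
  have hd' : (d : ℂ) ≠ 0 := Nat.cast_ne_zero.2 hd
  have hr' : (r : ℂ) ≠ 0 := Nat.cast_ne_zero.2 hr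
  have hord : addOrderOf (π (d : ℂ)) = r := addOrderOf_mk hd
  obtain ⟨K', hK'⟩ := exists_eq_bind_translates (by rwa [hord]) _ hM
  rw [hord] at hK'
  obtain ⟨K, rfl⟩ := Multiset.map_surjective_of_surjective
    (QuotientAddGroup.mk'_surjective (AddSubgroup.zmultiples ((d * r : ℕ) : ℂ))) K'
  have hmap : ∀ K : Multiset ℂ, (K.bind (translates (d : ℂ) r)).map π =
      (K.map π).bind (translates (π d) r) := fun K => by
    rw [Multiset.map_bind, Multiset.bind_map]
    simp only [map_translates]
  have hKcard : K.card = d := by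
    have := congrArg Multiset.card hK'
    rw [card_bind_translates, Multiset.card_map, Multiset.card_map, hcard] at this
    exact (Nat.eq_of_mul_eq_mul_right (Nat.pos_of_ne_zero hr) this).symm
  rw [← hπ, ← hmap] at hK'
  obtain ⟨n, hn⟩ : IntCongr (d * r) (K.bind (translates (d : ℂ) r)).sum M.sum := by
    rw [← mk_eq_mk_iff_intCongr]
    have := congrArg Multiset.sum hK'
    rw [← map_multiset_sum, ← map_multiset_sum] at this
    exact this.symm
  -- The sums differ by `d r n`. Replacing one `b` by `b + n d` changes the sum of its progression
  -- by `r · n d`, exactly the defect, and modulo `d r ℤ` only rotates that progression cyclically.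
  obtain ⟨b, K₁, rfl⟩ : ∃ b K₁, K = b ::ₘ K₁ := by
    rcases K.empty_or_exists_mem with rfl | ⟨b, hb⟩
    · exact absurd hKcard.symm hd
    · exact ⟨b, Multiset.exists_cons_of_mem hb⟩
  have hcard' : ((b + n • (d : ℂ)) ::ₘ K₁).card = d := by
    rw [← hKcard, Multiset.card_cons, Multiset.card_cons]
  have hsum' : (((b + n • (d : ℂ)) ::ₘ K₁).bind (translates (d : ℂ) r)).sum = M.sum := by
    rw [hn, Multiset.cons_bind, Multiset.cons_bind, Multiset.sum_add, Multiset.sum_add,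
      sum_translates, sum_translates, zsmul_eq_mul]
    push_cast
    ring
  refine ⟨(b + n • (d : ℂ)) ::ₘ K₁, hcard', ?_, hsum', ?_⟩
  -- The progressions add `d · d r (r - 1) / 2` to `r` times the sum of the first terms; subtracting
  -- this from `d r (d r - 1) / 2` leaves `r · d (d - 1) / 2`.
  · rw [sum_bind_translates, hcard', hsum] at hsum'
    refine mul_left_cancel₀ hr' ?_
    push_cast at hsum'
    linear_combination hsum'
  · rw [rel_intCongr_iff, ← hπ, hK', hmap, hmap, Multiset.map_cons, Multiset.map_cons,
      Multiset.cons_bind, Multiset.cons_bind, map_add, map_zsmul, translates_add_zsmul]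
    exact addOrderOf_dvd_iff_nsmul_eq_zero.1 (dvd_of_eq hord)

/-! ### Darboux transformations -/

/-- The polynomial that intertwines two Bessel operators with parameters congruent modulo `N`. -/
theorem exists_intertwiner {N : ℕ} {s t : Multiset ℂ} (h : Multiset.Rel (IntCongr N) s t) :
    ∃ l₀ : ℕ, ∀ l ≥ l₀, ∃ U : ℂ[X], U.Monic ∧
      (N * U.natDegree : ℂ) = t.sum - s.sum + N * l * s.card ∧
      ((t.map fun b => Polynomial.X - Polynomial.C b).prod).comp
          (Polynomial.X - Polynomial.C (N * l : ℂ)) * U =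
        U.comp (Polynomial.X - Polynomial.C (N : ℂ)) *
          (s.map fun b => Polynomial.X - Polynomial.C b).prod := by
  induction h with
  | zero => exact ⟨0, fun l _ => ⟨1, monic_one, by simp, by simp⟩⟩
  | @cons b b' s t hb _ ih =>
    obtain ⟨l₀, ih⟩ := ih
    obtain ⟨n, rfl⟩ := hb
    -- All factors must share the same shift `N l`, which is why the claim is made for every large
    -- `l`; `l ≥ |n|` makes the number `n + l` of linear factors nonnegative.
    refine ⟨max l₀ n.natAbs, fun l hl => ?_⟩
    obtain ⟨U, hU, hdeg, hcomm⟩ := ih l (le_trans (le_max_left _ _) hl)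
    obtain ⟨M, hM⟩ : ∃ M : ℕ, (M : ℤ) = n + l := by
      have : n.natAbs ≤ l := le_trans (le_max_right _ _) hl
      exact ⟨(n + l).toNat, Int.toNat_of_nonneg (by omega)⟩
    have hM' : (M : ℂ) = n + l := by exact_mod_cast congrArg (Int.cast : ℤ → ℂ) hM
    set V : ℂ[X] := ∏ j ∈ Finset.range M, (Polynomial.X - Polynomial.C (b + N * j)) with hV
    have hVm : V.Monic := monic_prod_of_monic _ _ fun j _ => monic_X_sub_C _
    have hVd : V.natDegree = M := by
      rw [hV, natDegree_prod_of_monic _ _ fun j _ => monic_X_sub_C _]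
      simp only [natDegree_X_sub_C, Finset.sum_const, Finset.card_range, smul_eq_mul, mul_one]
    -- Both sides are the product of the `X - (b + N j)` over `0 ≤ j ≤ M`: on the left the last
    -- factor is split off, on the right the first.
    have hVcomm : (Polynomial.X - Polynomial.C (b + N * n)).comp
        (Polynomial.X - Polynomial.C (N * l : ℂ)) * V =
          V.comp (Polynomial.X - Polynomial.C (N : ℂ)) * (Polynomial.X - Polynomial.C b) := by
      have h1 : V.comp (Polynomial.X - Polynomial.C (N : ℂ)) =
          ∏ j ∈ Finset.range M, (Polynomial.X - Polynomial.C (b + N * ((j + 1 : ℕ) : ℂ))) := by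
        rw [hV, Polynomial.prod_comp]
        refine Finset.prod_congr rfl fun j _ => ?_
        rw [sub_comp, X_comp, C_comp, sub_sub, ← Polynomial.C_add]
        congr 2
        push_cast
        ring
      have h2 := Finset.prod_range_succ' (fun j : ℕ => Polynomial.X - Polynomial.C (b + N * j : ℂ)) M
      rw [Finset.prod_range_succ] at h2
      rw [h1]
      simp only [Nat.cast_zero, mul_zero, add_zero] at h2
      rw [← h2, hM', hV, mul_comm]
      congr 1
      rw [sub_comp, X_comp, C_comp, sub_sub, ← Polynomial.C_add]
      congr 2
      ring
    refine ⟨U * V, hU.mul hVm, ?_, ?_⟩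
    · rw [hU.natDegree_mul hVm, hVd, Multiset.sum_cons, Multiset.sum_cons, Multiset.card_cons]
      push_cast
      rw [hM', mul_add, hdeg]
      ring
    · rw [Multiset.map_cons, Multiset.map_cons, Multiset.prod_cons, Multiset.prod_cons, mul_comp,
        mul_comp, mul_comm U V, mul_mul_mul_comm, hVcomm, hcomm]
      ring

theorem besselPoly_eq_prod {N : ℕ} (β : Fin N → ℂ) : besselPoly β =
    ((Finset.univ.val.map β).map fun b => Polynomial.X - Polynomial.C b).prod := by
  rw [Multiset.map_map]
  rfl

variable {N : ℕ} {β : Fin N → ℂ}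

theorem monic_besselPoly (β : Fin N → ℂ) : (besselPoly β).Monic :=
  monic_prod_of_monic _ _ fun _ _ => monic_X_sub_C _

theorem roots_besselPoly (β : Fin N → ℂ) : (besselPoly β).roots = Finset.univ.val.map β := by
  rw [besselPoly_eq_prod, roots_multiset_prod_X_sub_C]

theorem exists_diffOp_besselWave (hβ : IsBesselParam β) {β' : Fin N → ℂ} (hβ' : IsBesselParam β')
    (h : Multiset.Rel (IntCongr N) (Finset.univ.val.map β) (Finset.univ.val.map β')) :
    ∃ (k : ℕ), ∃ P ∈ DiffOp, aeval zWave (Polynomial.X ^ k : ℂ[X]) * besselWave β' =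
      P (besselWave β) := by
  obtain ⟨l, hl⟩ := exists_intertwiner h
  obtain ⟨U, hU, hdeg, hcomm⟩ := hl l le_rfl
  have hN : (N : ℂ) ≠ 0 := Nat.cast_ne_zero.2 (by have := hβ.1; omega)
  have hs : ∀ γ : Fin N → ℂ, (Finset.univ.val.map γ).sum = ∑ i, γ i := fun γ => rfl
  -- Equal sums of the parameters make the degree of `U` equal to the shift `N l`, so the power of
  -- `z` produced by `U(D_z)` matches the intertwining relation.
  have hdeg' : (U.natDegree : ℂ) = N * l := by
    refine mul_left_cancel₀ hN ?_
    rw [hdeg, hs, hs, hβ.2, hβ'.2, Multiset.card_map, Finset.card_val, Finset.card_fin]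
    ring
  rw [← besselPoly_eq_prod, ← besselPoly_eq_prod, ← hdeg'] at hcomm
  refine ⟨U.natDegree, mulX (xCoord⁻¹ ^ U.natDegree) * aeval eulerX U,
    mul_mem (mulX_mem_diffOp _) (aeval_eulerX_mem_diffOp U), ?_⟩
  rw [Module.End.mul_apply, besselWave_eq_dilate, besselWave_eq_dilate, aeval_eulerX_dilate,
    hβ.aeval_eq_zVar_pow_mul hβ' hU hcomm, dilate_zVar_pow_mul, mulX_inv_pow_mulX_pow, map_pow,
    aeval_X]

theorem isDarbouxTransform_of_rel (hβ : IsBesselParam β) {β' : Fin N → ℂ}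
    (hβ' : IsBesselParam β')
    (h : Multiset.Rel (IntCongr N) (Finset.univ.val.map β) (Finset.univ.val.map β')) :
    IsDarbouxTransform (besselWave β') (besselWave β) := by
  have h' := rel_intCongr_iff.2 (rel_intCongr_iff.1 h).symm
  obtain ⟨k, P, hP, hk⟩ := exists_diffOp_besselWave hβ' hβ h'
  obtain ⟨l, Q, hQ, hl⟩ := exists_diffOp_besselWave hβ hβ' h
  exact ⟨Polynomial.X ^ l, Polynomial.X ^ k, monic_X_pow _, monic_X_pow _, P, hP, Q, hQ, hk, hl⟩

/-- The Bessel function of a parameter of length `d` is also one for the parameter of length `d r`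
of the `r`-th power of its Bessel operator. -/
theorem besselWave_eq_of_bind_translates {d r : ℕ} (hβ : IsBesselParam β) {β' : Fin d → ℂ}
    (hβ' : IsBesselParam β') (hN : N = d * r)
    (h : Finset.univ.val.map β = (Finset.univ.val.map β').bind (translates (d : ℂ) r)) :
    besselWave β = besselWave β' := by
  -- The `j`-th terms of the progressions are the roots of `P_β'(X - d j)`. These are the factors
  -- met when the equation of `β'` is iterated, since each new `z^d` shifts `D_z` by `d`.
  have hpoly : besselPoly β = ∏ j ∈ Finset.range r, (besselPoly β').comp
      (Polynomial.X - Polynomial.C ((d * j : ℕ) : ℂ)) := by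
    have h1 : besselPoly β = ∏ i : Fin d, ∏ j ∈ Finset.range r,
        (Polynomial.X - Polynomial.C (β' i + j • (d : ℂ))) := by
      rw [besselPoly_eq_prod, h, Multiset.bind_map, Multiset.map_bind, Multiset.prod_bind]
      simp only [translates, Multiset.map_map]
      rfl
    rw [h1, Finset.prod_comm]
    refine Finset.prod_congr rfl fun j _ => ?_
    rw [besselPoly, Polynomial.prod_comp]
    refine Finset.prod_congr rfl fun i _ => ?_
    rw [sub_comp, X_comp, C_comp, nsmul_eq_mul, Polynomial.C_add, mul_comm]
    push_cast
    ring
  have hiter : ∀ r : ℕ, aeval eulerZ (∏ j ∈ Finset.range r, (besselPoly β').comp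
      (Polynomial.X - Polynomial.C ((d * j : ℕ) : ℂ))) (besselFun β') =
        zVar ^ (d * r) * besselFun β' := fun r => by
    induction r with
    | zero => simp
    | succ r ih =>
      rw [Finset.prod_range_succ, mul_comm, map_mul, Module.End.mul_apply, ih,
        aeval_eulerZ_comp_zVar_pow_mul, hβ'.aeval_besselFun, ← mul_assoc, ← pow_add, mul_add,
        mul_one]
  rw [besselWave_eq_dilate, besselWave_eq_dilate, ← hβ.eq_besselFun (coeff_besselFun_neg β')
    hβ'.coeff_besselFun_zero]
  rw [hpoly, hiter, hN]

/-! ### The spectral algebra -/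

theorem X_pow_mem_of_coeff_ne_zero {S : Submodule ℂ ℂ[X]}
    (hS : ∀ f ∈ S, Polynomial.X * derivative f ∈ S) {f : ℂ[X]} (hf : f ∈ S) {m : ℕ}
    (hm : f.coeff m ≠ 0) : Polynomial.X ^ m ∈ S := by
  induction hk : f.support.card using Nat.strong_induction_on generalizing f with
  | _ k ih =>
    by_cases h : ∃ j ∈ f.support, j ≠ m
    · obtain ⟨j, hj, hjm⟩ := h
      -- The operator `X d/dX - j` kills the term of degree `j` and multiplies that of degree `m` by
      -- `m - j ≠ 0`, so the support shrinks without losing `m`.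
      set g := Polynomial.X * derivative f - (j : ℂ) • f with hg
      have hcoeff : ∀ i, g.coeff i = ((i : ℂ) - j) * f.coeff i := fun i => by
        rw [hg, Polynomial.coeff_sub, Polynomial.coeff_smul, smul_eq_mul]
        rcases i with _ | i
        · simp
        · rw [Polynomial.coeff_X_mul, Polynomial.coeff_derivative]
          push_cast
          ring
      refine ih g.support.card ?_ (S.sub_mem (hS f hf) (S.smul_mem _ hf)) ?_ rfl
      · rw [← hk]
        refine Finset.card_lt_card (Finset.ssubset_iff_subset_ne.2 ⟨fun i hi => ?_, fun he => ?_⟩)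
        · rw [Polynomial.mem_support_iff, hcoeff] at hi
          exact Polynomial.mem_support_iff.2 (right_ne_zero_of_mul hi)
        · rw [← he, Polynomial.mem_support_iff, hcoeff, sub_self, zero_mul] at hj
          exact hj rfl
      · rw [hcoeff]
        exact mul_ne_zero (sub_ne_zero.2 (Nat.cast_injective.ne hjm.symm)) hm
    · push Not at h
      have : f = f.coeff m • Polynomial.X ^ m := by
        ext i
        rw [Polynomial.coeff_smul, Polynomial.coeff_X_pow, smul_eq_mul]
        split_ifs with hi
        · rw [hi, mul_one]
        · rw [mul_zero]
          by_contra h0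
          exact hi (h i (Polynomial.mem_support_iff.2 h0))
      rw [this] at hf
      exact (S.smul_mem_iff hm).1 hf

/-- The commutator of `D_z` with multiplication by `f(z)` is multiplication by `z f'(z)`; hence
stability of a plane under `D_z` passes to its spectral algebra as stability under `z d/dz`. -/
theorem aeval_zVar_X_mul_derivative (f : ℂ[X]) (w : ZSeries) :
    aeval zVar (Polynomial.X * derivative f) * w =
      eulerZ (aeval zVar f * w) - aeval zVar f * eulerZ w := by
  induction f using Polynomial.induction_on' with
  | add p q hp hq =>
    simp only [map_add, mul_add, add_mul, hp, hq]
    ring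
  | monomial n r =>
    rw [derivative_monomial, X_mul_monomial, aeval_monomial, aeval_monomial, ← Algebra.smul_def,
      ← Algebra.smul_def, smul_mul_assoc, smul_mul_assoc, smul_mul_assoc, map_smul,
      eulerZ_zVar_pow_mul, mul_add, smul_add, add_sub_cancel_left, mul_smul_comm, mul_smul]
    rcases n with _ | n
    · have h0 : ∀ v : ZSeries, ((0 : ℕ) : ℂ) • v = 0 := fun v => by
        rw [Nat.cast_zero]
        exact zero_smul ℂ v
      rw [h0, h0]
    · rfl

theorem mem_plane_besselWave (β : Fin N → ℂ) (w : ZSeries) :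
    w ∈ plane (besselWave β) ↔ ∃ U : ℂ[X], aeval eulerZ U (besselFun β) = w := by
  rw [besselWave_eq_dilate, mem_plane_dilate]

theorem X_mul_derivative_mem_spectralAlgebra {f : ℂ[X]}
    (hf : f ∈ spectralAlgebra (plane (besselWave β))) :
    Polynomial.X * derivative f ∈ spectralAlgebra (plane (besselWave β)) := by
  have heuler : ∀ w ∈ plane (besselWave β), eulerZ w ∈ plane (besselWave β) := fun w hw => by
    obtain ⟨U, rfl⟩ := (mem_plane_besselWave β w).1 hw
    exact (mem_plane_besselWave β _).2 ⟨Polynomial.X * U, by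
      rw [map_mul, aeval_X, Module.End.mul_apply]⟩
  intro w hw
  rw [aeval_zVar_X_mul_derivative]
  exact Submodule.sub_mem _ (heuler _ (hf w hw)) (hf _ (heuler w hw))

theorem IsBesselParam.X_pow_mem_spectralAlgebra (hβ : IsBesselParam β) :
    Polynomial.X ^ N ∈ spectralAlgebra (plane (besselWave β)) := by
  intro w hw
  obtain ⟨U, rfl⟩ := (mem_plane_besselWave β w).1 hw
  refine (mem_plane_besselWave β _).2
    ⟨U.comp (Polynomial.X - Polynomial.C (N : ℂ)) * besselPoly β, ?_⟩
  rw [map_mul, Module.End.mul_apply, hβ.aeval_besselFun, aeval_eulerZ_comp_zVar_pow_mul, map_pow,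
    aeval_X]

theorem roots_comp_X_sub_C (p : ℂ[X]) (a : ℂ) :
    (p.comp (Polynomial.X - Polynomial.C a)).roots = p.roots.map (· + a) := by
  simpa [sub_eq_add_neg] using p.roots_comp_C_mul_X_add_C 1 (-a) isUnit_one

/-- If `z ^ m` is in the spectral algebra, then the parameter is invariant under the translation by
`m` modulo `N ℤ`. -/
theorem IsBesselParam.mem_translationStabilizer (hβ : IsBesselParam β) {m : ℕ}
    (hm : Polynomial.X ^ m ∈ spectralAlgebra (plane (besselWave β))) :
    QuotientAddGroup.mk' (AddSubgroup.zmultiples (N : ℂ)) (m : ℂ) ∈ translationStabilizer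
      ((Finset.univ.val.map β).map (QuotientAddGroup.mk' (AddSubgroup.zmultiples (N : ℂ)))) := by
  set π := QuotientAddGroup.mk' (AddSubgroup.zmultiples (N : ℂ))
  obtain ⟨R, hR⟩ := (mem_plane_besselWave β _).1
    (hm (besselFun β) ((mem_plane_besselWave β _).2 ⟨1, by simp⟩))
  rw [map_pow, aeval_X] at hR
  -- Applied to `Ψ_β`, both sides give `z^(m + N) Ψ_β`.
  have hcomm : (besselPoly β).comp (Polynomial.X - Polynomial.C (m : ℂ)) * R =
      R.comp (Polynomial.X - Polynomial.C (N : ℂ)) * besselPoly β := by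
    refine hβ.aeval_eulerZ_injective ?_
    simp only [map_mul, Module.End.mul_apply]
    rw [hR, hβ.aeval_besselFun, aeval_eulerZ_comp_zVar_pow_mul, aeval_eulerZ_comp_zVar_pow_mul,
      hβ.aeval_besselFun, hR]
    ring
  have hR0 : R ≠ 0 := by
    rintro rfl
    rw [map_zero, LinearMap.zero_apply] at hR
    have := congrArg (fun c : ZSeries => c.coeff (-m)) hR
    simp only [coeff_zVar_pow_mul, neg_add_cancel, hβ.coeff_besselFun_zero,
      HahnSeries.coeff_zero] at this
    exact zero_ne_one this
  have hcomp : ∀ (p : ℂ[X]) (a : ℂ), p ≠ 0 →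
      p.comp (Polynomial.X - Polynomial.C a) ≠ 0 := fun p a hp h0 => by
    rcases comp_eq_zero_iff.1 h0 with h | ⟨_, h⟩
    · exact hp h
    · have := congrArg natDegree h
      rw [natDegree_X_sub_C, natDegree_C] at this
      exact one_ne_zero this
  have hP := (monic_besselPoly β).ne_zero
  have hroots := congrArg roots hcomm
  rw [roots_mul (mul_ne_zero (hcomp _ _ hP) hR0), roots_mul (mul_ne_zero (hcomp _ _ hR0) hP),
    roots_comp_X_sub_C, roots_comp_X_sub_C, roots_besselPoly] at hroots
  have hN : π (N : ℂ) = 0 :=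
    (QuotientAddGroup.eq_zero_iff _).2 (AddSubgroup.mem_zmultiples _)
  -- Modulo `N ℤ` the shift of the roots of `R` by `N` disappears, and these roots cancel.
  have hmap := congrArg (Multiset.map π) hroots
  have hadd : ∀ (s : Multiset ℂ) (a : ℂ), (s.map (· + a)).map π = (s.map π).map (· + π a) :=
    fun s a => by simp [Multiset.map_map]
  rw [Multiset.map_add, Multiset.map_add, hadd, hadd, hN, add_comm] at hmap
  simp only [add_zero, Multiset.map_id'] at hmap
  exact add_left_cancel hmap

theorem dvd_of_X_pow_mem_spectralAlgebra (hβ : IsBesselParam β) (hgen : IsGeneric β) {m : ℕ}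
    (hm : Polynomial.X ^ m ∈ spectralAlgebra (plane (besselWave β))) : N ∣ m := by
  by_contra hNm
  have hstab := hβ.mem_translationStabilizer hm
  have hN0 : N ≠ 0 := by have := hβ.1; omega
  set d := Nat.gcd m N with hd
  have hd0 : d ≠ 0 := Nat.gcd_ne_zero_right hN0
  obtain ⟨r, hr⟩ : d ∣ N := Nat.gcd_dvd_right m N
  have hr0 : r ≠ 0 := by
    rintro rfl
    exact hN0 hr
  have hdN : d < N := lt_of_le_of_ne (Nat.le_of_dvd (Nat.pos_of_ne_zero hN0) ⟨r, hr⟩) fun h =>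
    hNm (h ▸ Nat.gcd_dvd_left m N)
  have hstab' : QuotientAddGroup.mk' (AddSubgroup.zmultiples (N : ℂ)) (d : ℂ) ∈
      translationStabilizer ((Finset.univ.val.map β).map
        (QuotientAddGroup.mk' (AddSubgroup.zmultiples (N : ℂ)))) := by
    -- By Bézout: the stabilizer is a group, and `N` is zero in the quotient.
    have hbez : (d : ℂ) = Nat.gcdA m N • (m : ℂ) + Nat.gcdB m N • (N : ℂ) := by
      have := congrArg (Int.cast : ℤ → ℂ) (Nat.gcd_eq_gcd_ab m N)
      push_cast at this
      rw [zsmul_eq_mul, zsmul_eq_mul, hd, this]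
      ring
    have hN : QuotientAddGroup.mk' (AddSubgroup.zmultiples (N : ℂ)) (N : ℂ) = 0 :=
      (QuotientAddGroup.eq_zero_iff _).2 (AddSubgroup.mem_zmultiples _)
    rw [hbez, map_add, map_zsmul, map_zsmul, hN, zsmul_zero, add_zero]
    exact AddSubgroup.zsmul_mem _ hstab _
  clear_value d
  subst hr
  obtain ⟨K, hKcard, hKsum, hsum, hrel⟩ := exists_rel_bind_translates hd0 hr0
    (by rw [Multiset.card_map, Finset.card_val, Finset.card_fin]) hβ.2 hstab'
  obtain ⟨β', rfl⟩ := exists_map_univ_eq hKcard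
  obtain ⟨β'', hβ''⟩ := exists_map_univ_eq (N := d * r)
    (s := (Finset.univ.val.map β').bind (translates (d : ℂ) r))
    (by rw [card_bind_translates, hKcard])
  have hp' : IsBesselParam β' := ⟨Nat.pos_of_ne_zero hd0, hKsum⟩
  have hp'' : IsBesselParam β'' := ⟨hβ.1, by
    have h1 : (Finset.univ.val.map β'').sum = (Finset.univ.val.map β).sum := by rw [hβ'', hsum]
    exact h1.trans hβ.2⟩
  rw [← hβ''] at hrel
  refine hgen d hdN β' hp' ?_
  rw [← besselWave_eq_of_bind_translates hp'' hp' rfl hβ'']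
  exact isDarbouxTransform_of_rel hβ hp'' hrel

theorem spectralAlgebra_besselWave (hβ : IsBesselParam β) (hgen : IsGeneric β) :
    spectralAlgebra (plane (besselWave β)) =
      Algebra.adjoin ℂ {(Polynomial.X : ℂ[X]) ^ N} := by
  refine le_antisymm (fun f hf => ?_) (Algebra.adjoin_le ?_)
  · rw [f.as_sum_support_C_mul_X_pow]
    refine sum_mem fun m hm => ?_
    have hmem : Polynomial.X ^ m ∈ spectralAlgebra (plane (besselWave β)) :=
      X_pow_mem_of_coeff_ne_zero
        (S := Subalgebra.toSubmodule (spectralAlgebra (plane (besselWave β))))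
        (fun g hg => X_mul_derivative_mem_spectralAlgebra hg) hf (Polynomial.mem_support_iff.1 hm)
    obtain ⟨q, rfl⟩ := dvd_of_X_pow_mem_spectralAlgebra hβ hgen hmem
    rw [pow_mul, ← Polynomial.smul_eq_C_mul]
    exact Subalgebra.smul_mem _ (pow_mem (Algebra.self_mem_adjoin_singleton ℂ _) q) _
  · rw [Set.singleton_subset_iff]
    exact hβ.X_pow_mem_spectralAlgebra

/-! ### The algebra of operators -/

theorem besselOp_mem_diffOp (β : Fin N → ℂ) : besselOp β ∈ DiffOp :=
  mul_mem (mulX_mem_diffOp _) (aeval_eulerX_mem_diffOp _)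

theorem IsBesselParam.besselOp_apply (hβ : IsBesselParam β) :
    besselOp β (besselWave β) = aeval zWave (Polynomial.X ^ N : ℂ[X]) * besselWave β := by
  rw [besselOp, Module.End.mul_apply, besselWave_eq_dilate, aeval_eulerX_dilate,
    hβ.aeval_besselFun, dilate_zVar_pow_mul, mulX_inv_pow_mulX_pow, map_pow, aeval_X]

theorem IsBesselParam.aeval_besselOp_apply (hβ : IsBesselParam β) (h : ℂ[X]) :
    aeval (besselOp β) h (besselWave β) =
      aeval zWave (aeval (Polynomial.X ^ N : ℂ[X]) h) * besselWave β := by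
  induction h using Polynomial.induction_on' with
  | add p q hp hq => simp only [map_add, LinearMap.add_apply, hp, hq, add_mul]
  | monomial n r =>
    rw [aeval_monomial, aeval_monomial, Module.End.mul_apply, Module.algebraMap_end_apply, map_mul,
      AlgHom.commutes, ← Algebra.smul_def, smul_mul_assoc]
    congr 1
    induction n with
    | zero => simp
    | succ n ih =>
      rw [pow_succ', Module.End.mul_apply, ih, mul_aeval_zWave_comm (besselOp_mem_diffOp β),
        hβ.besselOp_apply, pow_succ, map_mul, mul_assoc]

/-- An eigenvalue in the spectral algebra has the form `h(z^N)`, so the operator and `h(L_β)` agree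
on `Ψ_β`; differential operators that agree there are equal. -/
theorem operatorAlgebra_besselWave (hβ : IsBesselParam β) (hgen : IsGeneric β) :
    operatorAlgebra (besselWave β) = Algebra.adjoin ℂ {besselOp β} := by
  refine le_antisymm ?_ (Algebra.adjoin_le ?_)
  · rintro L ⟨hL, f, hf, hLf⟩
    rw [spectralAlgebra_besselWave hβ hgen, Algebra.adjoin_singleton_eq_range_aeval] at hf
    obtain ⟨h, rfl⟩ := hf
    rw [Algebra.adjoin_singleton_eq_range_aeval]
    refine ⟨h, ?_⟩
    have hh : aeval (besselOp β) h ∈ DiffOp := by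
      rw [aeval_eq_sum_range]
      exact sum_mem fun i _ => DiffOp.smul_mem (pow_mem (besselOp_mem_diffOp β) i) _
    have hneg : ∀ n < 0, (besselWave β).coeff n = 0 := fun n hn => by
      rw [besselWave_eq_dilate, coeff_dilate, coeff_besselFun_neg β n hn, zero_smul]
    have hzero : (besselWave β).coeff 0 = 1 := by
      rw [besselWave_eq_dilate, coeff_dilate, hβ.coeff_besselFun_zero]
      simp
    have hsub : aeval (besselOp β) h + (-1 : ℂ) • L ∈ DiffOp :=
      DiffOp.add_mem hh (DiffOp.smul_mem hL _)
    have hsmul : ∀ m : WaveSpace, (-1 : ℂ) • m = -m := fun m => neg_one_smul ℂ m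
    have happly : ∀ m, (aeval (besselOp β) h + (-1 : ℂ) • L) m =
        aeval (besselOp β) h m - L m := fun m => by
      rw [LinearMap.add_apply, LinearMap.smul_apply, hsmul, sub_eq_add_neg]
    have hzero' := eq_zero_of_apply_eq_zero hsub hneg hzero (by
      rw [happly, hβ.aeval_besselOp_apply, sub_eq_zero]
      exact hLf.symm)
    refine LinearMap.ext fun m => sub_eq_zero.1 ((happly m).symm.trans ?_)
    rw [hzero', LinearMap.zero_apply]
  · rw [Set.singleton_subset_iff]
    exact ⟨besselOp_mem_diffOp β, Polynomial.X ^ N, hβ.X_pow_mem_spectralAlgebra,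
      hβ.besselOp_apply⟩

end BesselPlane

end

theorem mainTheorem10 (N : ℕ) (β : Fin N → ℂ) (hβ : BesselPlane.IsBesselParam β)
    (hgen : BesselPlane.IsGeneric β) :
    BesselPlane.spectralAlgebra (BesselPlane.plane (BesselPlane.besselWave β)) =
        Algebra.adjoin ℂ {(Polynomial.X : Polynomial ℂ) ^ N} ∧
      BesselPlane.operatorAlgebra (BesselPlane.besselWave β) =
        Algebra.adjoin ℂ {BesselPlane.besselOp β} :=
  ⟨BesselPlane.spectralAlgebra_besselWave hβ hgen, BesselPlane.operatorAlgebra_besselWave hβ hgen⟩
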